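/- Let $s\ge 2$ be an integer, let $\mathbb{Z}_s=\varprojlim \mathbb{Z}/s^k\mathbb{Z}$ be the compact ring of $s$-adic integers with its $s$-adic absolute value $|\cdot|_s$, and let $\mathcal{V}=\{(n,x)\mid n\in\mathbb{Z}_{\ge 0},\ 0\le x<s^n\}$. On the Hilbert space $\ell^2(\mathcal{V})$ with canonical basis $\{E_{(n,x)}\}$ define the isometry $U E_{(n,x)}=E_{(n+1,x+1)}$; for $f\in C(\mathbb{Z}_s)$ the operator $M_fE_{(n,x)}=f(x)E_{(n,x)}$; for $(n,x)\in\mathcal{V}$ the operator $M_{(n,x)}$ with $M_{(n,x)}E_{(m,y)}=E_{(m,y)}$ if $|y-x|_s\le s^{-n}$ and $M_{(n,x)}E_{(m,y)}=0$ otherwise; and for $k\in\mathbb{Z}_{\ge0}$ the projection $P_k=U^k(I-UU^*)(U^*)^k$. Write $C^*(S)$ for the smallest norm-closed $*$-subalgebra of bounded operators (not assumed unital) containing $S$. Put $$A_U=C^*(U,M_f\mid f\in C(\mathbb{Z}_s)),\qquad I_U=C^*(M_fP_k\mid f\in C(\mathbb{Z}_s),\,k\ge0),\qquad \mathcal{I}_U=C^*(aU^m\mid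 a\in I_U,\,m\ge0),$$ and, for $n\in\mathbb{Z}_{\ge0}$, $$A_{U,n}=C^*(U,M_{(n,x)}\mid 0\le x<s^n),\qquad I_{U,n}=C^*(P_kM_{(n,x)}\mid k\ge0,\,0\le x<s^n),\qquad \mathcal{I}_{U,n}=C^*(aU^m\mid a\in I_{U,n},\,m\ge0).$$ Let $\mathcal{K}$ be the $C^*$-algebra of compact operators on an infinite-dimensional separable complex Hilbert space. Then $\mathcal{I}_U$ is a two-sided ideal of $A_U$, and there is an isomorphism of $C^*$-algebras $$\mathcal{I}_U\cong C(\mathbb{Z}_s)\otimes\mathcal{K}.$$ Likewise, for every $n\in\mathbb{Z}_{\ge0}$, $\mathcal{I}_{U,n}$ is a two-sided ideal of $A_{U,n}$, and $$\mathcal{I}_{U,n}\cong\mathbb{C}^{s^n}\otimes\mathcal{K}.$$ Here $\otimes$ is the $C^*$-tensor product (taken with the maximal $C^*$-norm; the $C^*$-norm is unique here because commutative $C^*$-algebras are nuclear). -/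

import Mathlib

open scoped ENNReal

noncomputable section

namespace ShiftAlgebra

universe u v

/-! ### C*-algebras generated by sets, compact operators, C*-tensor products -/

/-- `C*(S)`: the smallest closed `*`-subalgebra (not assumed to contain a unit) containing `S`. -/
def cstarGen {A : Type*} [NonUnitalCStarAlgebra A] (S : Set A) : NonUnitalStarSubalgebra ℂ A :=
  (NonUnitalStarAlgebra.adjoin ℂ S).topologicalClosure

/-- `I` is a two-sided ideal contained in the subalgebra `A` of an ambient algebra. -/
def IsIdealOf {𝔸 : Type*} [NonUnitalCStarAlgebra 𝔸] (I A : NonUnitalStarSubalgebra ℂ 𝔸) : Prop :=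
  I ≤ A ∧ ∀ x ∈ I, ∀ a ∈ A, a * x ∈ I ∧ x * a ∈ I

section Compact

variable {E : Type*} [NormedAddCommGroup E] [InnerProductSpace ℂ E] [CompleteSpace E]

theorem isCompactOperator_star {T : E →L[ℂ] E} (hT : IsCompactOperator T) :
    IsCompactOperator (star T : E →L[ℂ] E) := by
  set S : E →L[ℂ] E := star T with hS
  have hTS : IsCompactOperator (T ∘ S) := hT.comp_clm S
  have key : ∀ x : E, ‖S x‖ ^ 2 ≤ ‖T (S x)‖ * ‖x‖ := by
    intro x
    have h1 : inner ℂ (S x) (S x) = inner ℂ (T (S x)) x := by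
      rw [hS, ContinuousLinearMap.star_eq_adjoint, ContinuousLinearMap.adjoint_inner_right]
    calc ‖S x‖ ^ 2 = ‖inner ℂ (S x) (S x)‖ := by
            rw [inner_self_eq_norm_sq_to_K]; simp
      _ = ‖inner ℂ (T (S x)) x‖ := by rw [h1]
      _ ≤ _ := norm_inner_le_norm _ _
  have hTS' : IsCompactOperator ((T ∘L S : E →L[ℂ] E) : E →ₗ[ℂ] E) := hTS
  change IsCompactOperator (S : E →ₗ[ℂ] E)
  rw [isCompactOperator_iff_isCompact_closure_image_closedBall (S : E →ₗ[ℂ] E) one_pos]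
  have hc := hTS'.isCompact_closure_image_closedBall 1
  refine TotallyBounded.isCompact_of_isClosed (TotallyBounded.closure ?_) isClosed_closure
  have htb := hc.totallyBounded.subset subset_closure
  rw [Metric.totallyBounded_iff]
  intro ε hε
  obtain ⟨t, hts, htf, hcov⟩ :=
    Metric.finite_approx_of_totallyBounded htb (ε ^ 2 / 2) (by positivity)
  obtain ⟨w, hw, hwf, rfl⟩ := Set.exists_subset_image_finite_and.1 ⟨t, hts, htf, rfl⟩
  refine ⟨S '' w, hwf.image _, ?_⟩
  rintro _ ⟨x, hx, rfl⟩
  have := hcov ⟨x, hx, rfl⟩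
  simp only [Set.mem_iUnion, Set.mem_image, exists_prop, exists_exists_and_eq_and] at this ⊢
  obtain ⟨y, hy, hxy⟩ := this
  refine ⟨y, hy, ?_⟩
  have hx1 : ‖x‖ ≤ 1 := by simpa using hx
  have hy1 : ‖y‖ ≤ 1 := by simpa using hw hy
  have hk := key (x - y)
  have h2 : ‖x - y‖ ≤ 2 := (norm_sub_le x y).trans (by linarith)
  have hd : ‖T (S (x - y))‖ < ε ^ 2 / 2 := by
    have : dist (T (S x)) (T (S y)) < ε ^ 2 / 2 := hxy
    rwa [dist_eq_norm, ← map_sub, ← map_sub] at this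
  have h3 : ‖S (x - y)‖ ^ 2 < ε ^ 2 := by
    nlinarith [norm_nonneg (T (S (x - y))), norm_nonneg (x - y)]
  have h4 := lt_of_pow_lt_pow_left₀ 2 hε.le h3
  rw [map_sub] at h4
  simpa [Metric.mem_ball, dist_eq_norm] using h4

variable (E) in
/-- The C*-algebra `𝒦(E)` of compact operators on the Hilbert space `E`. -/
def compactOps : NonUnitalStarSubalgebra ℂ (E →L[ℂ] E) where
  carrier := {T | IsCompactOperator T}
  add_mem' ha hb := IsCompactOperator.add ha hb
  zero_mem' := isCompactOperator_zero
  mul_mem' {_ b} ha _ := IsCompactOperator.comp_clm ha b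
  smul_mem' c _ ha := IsCompactOperator.smul ha c
  star_mem' ha := isCompactOperator_star ha

instance : NonUnitalCStarAlgebra (compactOps E) :=
  NonUnitalStarSubalgebra.nonUnitalCStarAlgebra (compactOps E)
    (h_closed := isClosed_setOfPred_isCompactOperator)

end Compact

section Tensor

variable (A : Type u) (B : Type v) [NonUnitalCStarAlgebra A] [NonUnitalCStarAlgebra B]

/-- A pair of commuting `*`-representations of `A` and `B` on one Hilbert space. -/
structure CommutingReps where
  H : Type (max u v)
  [normed : NormedAddCommGroup H]
  [inner : InnerProductSpace ℂ H]
  [complete : CompleteSpace H]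
  π : A →⋆ₙₐ[ℂ] (H →L[ℂ] H)
  ρ : B →⋆ₙₐ[ℂ] (H →L[ℂ] H)
  commute : ∀ a b, Commute (π a) (ρ b)

attribute [instance] CommutingReps.normed CommutingReps.inner CommutingReps.complete

/-- The C*-algebra of all bounded families of operators, one on the Hilbert space of each
commuting pair of representations, with the supremum norm. -/
abbrev CommutingReps.Prod : Type _ := lp (fun P : CommutingReps A B => P.H →L[ℂ] P.H) ∞

variable {A B} in
/-- The elementary tensor `a ⊗ b`, as the family of the operators `π(a)ρ(b)`. -/
def tmul (a : A) (b : B) : CommutingReps.Prod A B :=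
  ⟨fun P => P.π a * P.ρ b, by
    refine memℓp_infty ⟨‖a‖ * ‖b‖, ?_⟩
    rintro _ ⟨P, rfl⟩
    exact (norm_mul_le _ _).trans (mul_le_mul (NonUnitalStarAlgHom.norm_apply_le P.π a)
      (NonUnitalStarAlgHom.norm_apply_le P.ρ b) (norm_nonneg _) (norm_nonneg _))⟩

/-- The closed linear span of the elementary tensors (a C*-algebra, since the product of two
elementary tensors is again one). -/
def tensorSubalgebra : NonUnitalStarSubalgebra ℂ (CommutingReps.Prod A B) :=
  cstarGen {t | ∃ (a : A) (b : B), t = tmul a b}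

/-- The C*-tensor product `A ⊗ B`: the completion of the algebraic tensor product in the norm
`‖∑ aᵢ ⊗ bᵢ‖ = sup ‖∑ π(aᵢ)ρ(bᵢ)‖`, over all commuting pairs of representations `π` of `A` and
`ρ` of `B`. This is the maximal C*-norm. If `A` or `B` is nuclear (for instance commutative)
then it is the only C*-norm on the algebraic tensor product. -/
def CStarTensor : Type _ := tensorSubalgebra A B

instance : NonUnitalCStarAlgebra (CStarTensor A B) :=
  NonUnitalStarSubalgebra.nonUnitalCStarAlgebra (tensorSubalgebra A B)
    (h_closed := NonUnitalStarSubalgebra.isClosed_topologicalClosure _)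

end Tensor

/-! ### The `s`-adic integers -/

variable (s : ℕ)

/-- The ring `ℤ_s` of `s`-adic integers as the inverse limit of the rings `ℤ/sⁿℤ`, with the
topology induced from the product of the discrete spaces `ℤ/sⁿℤ`. -/
def Zs : Subring (∀ n : ℕ, ZMod (s ^ n)) where
  carrier := {x | ∀ (m n : ℕ) (h : m ≤ n), ZMod.castHom (pow_dvd_pow s h) (ZMod (s ^ m)) (x n) = x m}
  zero_mem' m n h := map_zero _
  one_mem' m n h := map_one _
  add_mem' hx hy m n h := by simp only [Pi.add_apply, map_add, hx m n h, hy m n h]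
  mul_mem' hx hy m n h := by simp only [Pi.mul_apply, map_mul, hx m n h, hy m n h]
  neg_mem' hx m n h := by simp only [Pi.neg_apply, map_neg, hx m n h]

instance [NeZero s] : CompactSpace (Zs s) := by
  refine isCompact_iff_compactSpace.1 (IsClosed.isCompact ?_)
  have : ((Zs s : Subring _) : Set (∀ n : ℕ, ZMod (s ^ n))) = ⋂ (m : ℕ) (n : ℕ) (h : m ≤ n),
      {x | ZMod.castHom (pow_dvd_pow s h) (ZMod (s ^ m)) (x n) = x m} := by
    ext x
    simp only [Set.mem_iInter]
    rfl
  rw [this]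
  refine isClosed_iInter fun m => isClosed_iInter fun n => isClosed_iInter fun h => ?_
  exact isClosed_eq (continuous_of_discreteTopology.comp (continuous_apply n)) (continuous_apply m)

instance [s.AtLeastTwo] : NeZero s := ⟨by have := Nat.AtLeastTwo.prop (n := s); omega⟩

open Classical in
/-- The `s`-adic absolute value: `s⁻ʲ` if `xⱼ` is the first nonzero digit of `x`, that is, if `j`
is the least index such that `x` is nonzero modulo `s ^ (j + 1)`; and `0` if `x = 0`. -/
def sabs (x : Zs s) : ℝ :=
  if h : ∃ j : ℕ, (x : ∀ n, ZMod (s ^ n)) (j + 1) ≠ 0 then ((s : ℝ) ^ Nat.find h)⁻¹ else 0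

/-! ### The Hilbert space `ℓ²(𝒱)` and its operators -/

/-- The set `𝒱` of balls of `ℤ_s`: pairs `(n, x)` with `0 ≤ x < sⁿ`. -/
abbrev Ball : Type := Σ n : ℕ, Fin (s ^ n)

/-- The Hilbert space `ℓ²(𝒱)`. -/
abbrev Hilb : Type := lp (fun _ : Ball s => ℂ) 2

/-- The canonical basis vector `E_(n,x)`. -/
def basisVec (b : Ball s) : Hilb s := lp.single 2 b 1

variable {s} in
/-- The diagonal operator `E_b ↦ φ(b) E_b` of a bounded function `φ` on `𝒱`. -/
def diag (φ : Ball s → ℂ) (C : ℝ) (hφ : ∀ b, ‖φ b‖ ≤ C) : Hilb s →L[ℂ] Hilb s :=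
  have hle : ∀ (g : Hilb s) (b : Ball s), ‖φ b * g b‖ ≤ ‖((C : ℂ) • g) b‖ := fun g b => by
    rw [lp.coeFn_smul, Pi.smul_apply, smul_eq_mul, norm_mul, norm_mul]
    refine mul_le_mul_of_nonneg_right ?_ (norm_nonneg _)
    simpa using (hφ b).trans (le_abs_self C)
  LinearMap.mkContinuous
    { toFun := fun g => ⟨fun b => φ b * g b, (lp.memℓp ((C : ℂ) • g)).mono' (hle g)⟩
      map_add' := fun g h => by ext b; exact mul_add _ _ _
      map_smul' := fun c g => by ext b; simp [mul_left_comm] }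
    |C| (fun g => by
      refine (lp.norm_mono (p := 2) (by norm_num) (hle g)).trans ?_
      rw [norm_smul]; simp)

theorem diag_basisVec (φ : Ball s → ℂ) (C : ℝ) (hφ : ∀ b, ‖φ b‖ ≤ C) (b : Ball s) :
    diag φ C hφ (basisVec s b) = φ b • basisVec s b := by
  ext c
  by_cases h : c = b
  · subst h; simp [diag, basisVec]
  · simp [diag, basisVec, h]

section Operators

variable [s.AtLeastTwo]

/-- The map `(n, x) ↦ (n + 1, x + 1)` on balls. -/
def next (b : Ball s) : Ball s :=
  ⟨b.1 + 1, ⟨b.2 + 1, by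
    have h1 := b.2.isLt
    have h2 : 2 ≤ s := Nat.AtLeastTwo.prop
    calc (b.2 : ℕ) + 1 < s ^ b.1 + s ^ b.1 := by omega
      _ = s ^ b.1 * 2 := by ring
      _ ≤ s ^ (b.1 + 1) := by rw [pow_succ]; exact Nat.mul_le_mul_left _ h2⟩⟩

theorem next_injective : Function.Injective (next s) := by
  rintro ⟨n, x⟩ ⟨m, y⟩ h
  simp only [next, Sigma.mk.injEq] at h
  obtain ⟨h1, h2⟩ := h
  obtain rfl : n = m := by omega
  simp only [heq_eq_eq, Fin.mk.injEq] at h2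
  obtain rfl : x = y := by ext; omega
  rfl

theorem orthonormal_next : Orthonormal ℂ (fun b => basisVec s (next s b)) := by
  have h : Orthonormal ℂ (basisVec s) := by
    rw [orthonormal_iff_ite]
    intro b c
    by_cases hbc : b = c
    · subst hbc; simp [basisVec]
    · simp [basisVec, lp.inner_single_left, hbc]
  exact h.comp _ (next_injective s)

/-- The Bunce--Deddens shift: the isometry `U` of `ℓ²(𝒱)` with `U E_(n,x) = E_(n+1,x+1)`. -/
def U : Hilb s →L[ℂ] Hilb s :=
  (orthonormal_next s).orthogonalFamily.linearIsometry.toContinuousLinearMap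

theorem U_basisVec (b : Ball s) : U s (basisVec s b) = basisVec s (next s b) := by
  simp [U, basisVec]

/-- The multiplication operator `M_f E_(n,x) = f(x) E_(n,x)` of `f ∈ C(ℤ_s)`. -/
def M (f : C(Zs s, ℂ)) : Hilb s →L[ℂ] Hilb s :=
  diag (fun b => f ((b.2 : ℕ) : Zs s)) ‖f‖ (fun _ => f.norm_coe_le_norm _)

open Classical in
/-- The operator `M_(n,x)`, multiplication by the characteristic function of the ball of radius
`s⁻ⁿ` about `x`: `M_(n,x) E_(m,y)` is `E_(m,y)` if `|y - x|_s ≤ s⁻ⁿ` and `0` otherwise. -/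
def Mball (c : Ball s) : Hilb s →L[ℂ] Hilb s :=
  diag (fun b => if sabs s (((b.2 : ℕ) : Zs s) - ((c.2 : ℕ) : Zs s)) ≤ ((s : ℝ) ^ c.1)⁻¹
    then 1 else 0) 1 (fun b => by split_ifs <;> simp)

/-- The projections `P₀ = I - UU*` and `Pₖ = Uᵏ P₀ (U*)ᵏ`. -/
def P (k : ℕ) : Hilb s →L[ℂ] Hilb s :=
  U s ^ k * (1 - U s * star (U s)) * star (U s) ^ k

/-! ### The algebras -/

/-- `A_U = C*(U, M_f | f ∈ C(ℤ_s))`. -/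
def algA : NonUnitalStarSubalgebra ℂ (Hilb s →L[ℂ] Hilb s) :=
  cstarGen ({U s} ∪ {T | ∃ f : C(Zs s, ℂ), T = M s f})

/-- `I_U = C*(M_f Pₖ | f ∈ C(ℤ_s), k ≥ 0)`. -/
def coeffIdeal : NonUnitalStarSubalgebra ℂ (Hilb s →L[ℂ] Hilb s) :=
  cstarGen {T | ∃ (f : C(Zs s, ℂ)) (k : ℕ), T = M s f * P s k}

/-- `ℐ_U = C*(a Uᵐ | a ∈ I_U, m ≥ 0)`. -/
def shiftIdeal : NonUnitalStarSubalgebra ℂ (Hilb s →L[ℂ] Hilb s) :=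
  cstarGen {T | ∃ a ∈ coeffIdeal s, ∃ m : ℕ, T = a * U s ^ m}

/-- `A_{U,n} = C*(U, M_(n,x) | 0 ≤ x < sⁿ)`. -/
def algAn (n : ℕ) : NonUnitalStarSubalgebra ℂ (Hilb s →L[ℂ] Hilb s) :=
  cstarGen ({U s} ∪ {T | ∃ x : Fin (s ^ n), T = Mball s ⟨n, x⟩})

/-- `I_{U,n} = C*(Pₖ M_(n,x) | k ≥ 0, 0 ≤ x < sⁿ)`. -/
def coeffIdealn (n : ℕ) : NonUnitalStarSubalgebra ℂ (Hilb s →L[ℂ] Hilb s) :=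
  cstarGen {T | ∃ (k : ℕ) (x : Fin (s ^ n)), T = P s k * Mball s ⟨n, x⟩}

/-- `ℐ_{U,n} = C*(a Uᵐ | a ∈ I_{U,n}, m ≥ 0)`. -/
def shiftIdealn (n : ℕ) : NonUnitalStarSubalgebra ℂ (Hilb s →L[ℂ] Hilb s) :=
  cstarGen {T | ∃ a ∈ coeffIdealn s n, ∃ m : ℕ, T = a * U s ^ m}

end Operators

end ShiftAlgebra

end

open scoped ENNReal

noncomputable section

namespace ShiftAlgebra

/-! ### Generated C*-algebras and isometric homomorphisms between them -/

section Generated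

variable {A B : Type*} [NonUnitalCStarAlgebra A] [NonUnitalCStarAlgebra B]

/-! Write `p = 1 - UU*` and `τ f = f(· + 1)`. Then `M_f U = U M_{τf}`, so `p` commutes with every
`M_f`, and the operators `Uⁱ M_f p (U*)ʲ` multiply like `f ⊗ eᵢⱼ`. They generate `ℐ_U`: one has `M_f
Pₖ = Uᵏ M_{τᵏf} p (U*)ᵏ`, and since `τ` is onto these are all the diagonal units; right
multiplication by powers of `U` gives the entries below the diagonal, and adjoints give those above.
Multiplying a unit by `U`, `U*` or `M_g` gives a unit or zero, hence the ideal property.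

It remains to see that such a system of units determines its C*-algebra
(`IsMatrixSystem.nonempty_equiv`). A finite sum of units is the image of a matrix under an injective
`*`-homomorphism from `M_N(A)`. Injective `*`-homomorphisms of C*-algebras are isometric, so the
norm of the sum depends on the matrix alone. The elementary tensors `a ⊗ eᵢⱼ` form another system
over the same `A`, and they generate `A ⊗ 𝒦` because the `eᵢⱼ` span a dense subspace of `𝒦`.

The concrete input is faithfulness: `M_f p = 0` must force `f = 0`. This holds because the second
coordinates of the balls outside the range of `next` are dense in `ℤ_s`
(`eq_zero_of_forall_initial`). At level `n` the same argument runs with `A` the functions on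
residues modulo `sⁿ`. The structure `IsShiftRep` covers both cases. -/

theorem subset_cstarGen (S : Set A) : S ⊆ cstarGen S :=
  (NonUnitalStarAlgebra.subset_adjoin ℂ S).trans
    (NonUnitalStarSubalgebra.le_topologicalClosure _)

theorem isClosed_cstarGen (S : Set A) : IsClosed (cstarGen S : Set A) :=
  NonUnitalStarSubalgebra.isClosed_topologicalClosure _

theorem cstarGen_le {S : Set A} {T : NonUnitalStarSubalgebra ℂ A} (h : S ⊆ T)
    (hT : IsClosed (T : Set A)) : cstarGen S ≤ T :=
  NonUnitalStarSubalgebra.topologicalClosure_minimal _ (NonUnitalStarAlgebra.adjoin_le h) hT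

theorem cstarGen_eq {S T : Set A} (h : S ⊆ cstarGen T) (h' : T ⊆ cstarGen S) :
    cstarGen S = cstarGen T :=
  le_antisymm (cstarGen_le h (isClosed_cstarGen T)) (cstarGen_le h' (isClosed_cstarGen S))

/-- The adjoined `*`-algebra is the span of the semigroup generated by `S ∪ star S`, which here is
`S` itself. -/
theorem cstarGen_eq_closure_span {S : Set A} (hmul : ∀ x ∈ S, ∀ y ∈ S, x * y ∈ S)
    (hstar : ∀ x ∈ S, star x ∈ S) :
    (cstarGen S : Set A) = closure (Submodule.span ℂ S : Set A) := by
  have h1 : S ∪ star S = S :=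
    Set.union_eq_left.2 fun x hx => by simpa using hstar _ (Set.mem_star.1 hx)
  have h2 : (Subsemigroup.closure (S ∪ star S) : Set A) = S := by
    rw [h1]
    exact congrArg _ (Subsemigroup.closure_eq (⟨S, fun {x y} hx hy => hmul x hx y hy⟩ :
      Subsemigroup A))
  have h3 := NonUnitalStarAlgebra.adjoin_eq_span (R := ℂ) S
  rw [h2] at h3
  rw [← h3]
  rfl

/-- A `*`-homomorphism which is isometric on the `*`-algebra spanned by a set identifies the
C*-algebra generated by this set with the one generated by its image. -/
theorem nonempty_equiv_image (φ : A →⋆ₙₐ[ℂ] B) (S : Set A)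
    (hφ : ∀ x ∈ NonUnitalStarAlgebra.adjoin ℂ S, ‖φ x‖ = ‖x‖) :
    Nonempty (cstarGen S ≃⋆ₐ[ℂ] cstarGen (φ '' S)) := by
  have hc : Continuous φ :=
    AddMonoidHomClass.continuous_of_bound φ 1 fun x => by
      simpa using NonUnitalStarAlgHom.norm_apply_le φ x
  have hiso : ∀ x ∈ cstarGen S, ‖φ x‖ = ‖x‖ := fun x hx =>
    closure_minimal hφ (isClosed_eq (by fun_prop) continuous_norm) hx
  have hmem : ∀ x : cstarGen S, φ x ∈ cstarGen (φ '' S) := fun x => by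
    refine map_mem_closure hc x.2 fun y hy => ?_
    have : φ y ∈ NonUnitalStarSubalgebra.map φ (NonUnitalStarAlgebra.adjoin ℂ S) := ⟨y, hy, rfl⟩
    rwa [NonUnitalStarAlgHom.map_adjoin] at this
  let ψ : cstarGen S →⋆ₙₐ[ℂ] cstarGen (φ '' S) :=
    NonUnitalStarAlgHom.codRestrict
      (φ.comp (NonUnitalStarSubalgebraClass.subtype (cstarGen S))) _ hmem
  have hψ : ∀ x, ‖ψ x‖ = ‖x‖ := fun x => hiso x x.2
  have hψi : Isometry ψ := AddMonoidHomClass.isometry_of_norm ψ hψ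
  refine ⟨StarAlgEquiv.ofBijective ψ ⟨hψi.injective, ?_⟩⟩
  have : CompleteSpace (cstarGen S) := (isClosed_cstarGen S).completeSpace_coe
  let χ : cstarGen S →⋆ₙₐ[ℂ] B := φ.comp (NonUnitalStarSubalgebraClass.subtype (cstarGen S))
  have hχ : Isometry χ := AddMonoidHomClass.isometry_of_norm χ fun x => hiso x x.2
  have hle : cstarGen (φ '' S) ≤ NonUnitalStarAlgHom.range χ := by
    refine cstarGen_le ?_ ?_
    · rintro _ ⟨x, hx, rfl⟩
      exact ⟨⟨x, subset_cstarGen S hx⟩, rfl⟩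
    · rw [NonUnitalStarAlgHom.coe_range]
      exact hχ.isClosedEmbedding.isClosed_range
  rintro ⟨y, hy⟩
  obtain ⟨x, hx⟩ := hle hy
  exact ⟨x, Subtype.ext hx⟩

end Generated

/-! ### Matrix systems and the uniqueness of the C*-algebra they generate -/

section MatrixSystem

variable {A : Type*} [CStarAlgebra A]

/-- Linear maps `W i j` which multiply like the maps `a ↦ a ⊗ eᵢⱼ` into `A ⊗ 𝒦`. -/
structure IsMatrixSystem {C : Type*} [NonUnitalCStarAlgebra C] (W : ℕ → ℕ → A →ₗ[ℂ] C) :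
    Prop where
  mul_eq : ∀ i j k a b, W i j a * W j k b = W i k (a * b)
  mul_eq_zero : ∀ i j k l a b, j ≠ k → W i j a * W k l b = 0
  star_eq : ∀ i j a, star (W i j a) = W j i (star a)
  injective : Function.Injective (W 0 0)

/-- The union of the ranges of the maps `W i j`. -/
def matrixSet {C : Type*} [NonUnitalCStarAlgebra C] (W : ℕ → ℕ → A →ₗ[ℂ] C) : Set C :=
  {x | ∃ i j a, x = W i j a}

/-- The linear combination `∑ W i j (f (i, j))`. -/
def matrixSum {C : Type*} [NonUnitalCStarAlgebra C] (W : ℕ → ℕ → A →ₗ[ℂ] C) :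
    ((ℕ × ℕ) →₀ A) →ₗ[ℂ] C :=
  Finsupp.lsum ℂ fun p => W p.1 p.2

namespace IsMatrixSystem

variable {C D : Type*} [NonUnitalCStarAlgebra C] [NonUnitalCStarAlgebra D]
  {W : ℕ → ℕ → A →ₗ[ℂ] C} {V : ℕ → ℕ → A →ₗ[ℂ] D}

theorem matrixSet_mul (hW : IsMatrixSystem W) (x : C) (hx : x ∈ matrixSet W) (y : C)
    (hy : y ∈ matrixSet W) : x * y ∈ matrixSet W := by
  obtain ⟨i, j, a, rfl⟩ := hx
  obtain ⟨k, l, b, rfl⟩ := hy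
  by_cases h : j = k
  · subst h
    exact ⟨i, l, a * b, hW.mul_eq ..⟩
  · exact ⟨0, 0, 0, by rw [hW.mul_eq_zero _ _ _ _ _ _ h, map_zero]⟩

theorem matrixSet_star (hW : IsMatrixSystem W) (x : C) (hx : x ∈ matrixSet W) :
    star x ∈ matrixSet W := by
  obtain ⟨i, j, a, rfl⟩ := hx
  exact ⟨j, i, star a, hW.star_eq ..⟩

theorem cstarGen_eq_closure (hW : IsMatrixSystem W) :
    (cstarGen (matrixSet W) : Set C) = closure (Submodule.span ℂ (matrixSet W) : Set C) :=
  cstarGen_eq_closure_span hW.matrixSet_mul hW.matrixSet_star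

theorem exists_matrixSum (hW : IsMatrixSystem W) {x : C}
    (hx : x ∈ NonUnitalStarAlgebra.adjoin ℂ (matrixSet W)) : ∃ f, matrixSum W f = x := by
  induction hx using NonUnitalStarAlgebra.adjoin_induction with
  | mem x hx =>
    obtain ⟨i, j, a, rfl⟩ := hx
    exact ⟨Finsupp.single (i, j) a, by simp [matrixSum]⟩
  | add x y _ _ hx hy =>
    obtain ⟨f, rfl⟩ := hx
    obtain ⟨g, rfl⟩ := hy
    exact ⟨f + g, map_add _ _ _⟩
  | zero => exact ⟨0, map_zero _⟩
  | mul x y _ _ hx hy =>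
    obtain ⟨f, rfl⟩ := hx
    obtain ⟨g, rfl⟩ := hy
    change _ ∈ LinearMap.range (matrixSum W)
    simp only [matrixSum, Finsupp.coe_lsum, Finsupp.sum, Finset.sum_mul_sum]
    refine Submodule.sum_mem _ fun p _ => Submodule.sum_mem _ fun q _ => ?_
    obtain ⟨i, j, a, h⟩ := hW.matrixSet_mul _ ⟨p.1, p.2, f p, rfl⟩ _ ⟨q.1, q.2, g q, rfl⟩
    rw [h]
    exact ⟨Finsupp.single (i, j) a, by simp⟩
  | smul r x _ hx =>
    obtain ⟨f, rfl⟩ := hx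
    exact ⟨r • f, map_smul _ _ _⟩
  | star x _ hx =>
    obtain ⟨f, rfl⟩ := hx
    change _ ∈ LinearMap.range (matrixSum W)
    simp only [matrixSum, Finsupp.coe_lsum, Finsupp.sum, star_sum]
    refine Submodule.sum_mem _ fun p _ => ?_
    rw [hW.star_eq]
    exact ⟨Finsupp.single (p.2, p.1) (star (f p)), by simp⟩

/-- The homomorphism `M_N(A) → C` of a matrix system. -/
def toHom (hW : IsMatrixSystem W) (N : ℕ) : CStarMatrix (Fin N) (Fin N) A →⋆ₙₐ[ℂ] C where
  toFun m := ∑ i : Fin N, ∑ j : Fin N, W i j (m i j)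
  map_smul' c m := by simp [Finset.smul_sum]
  map_zero' := by simp
  map_add' m m' := by simp [Finset.sum_add_distrib]
  map_mul' m m' := by
    simp only [CStarMatrix.mul_apply, map_sum, Finset.sum_mul_sum]
    refine Finset.sum_congr rfl fun i _ => ?_
    refine Finset.sum_comm.trans (Finset.sum_congr rfl fun j _ => ?_)
    symm
    rw [Finset.sum_eq_single j]
    · exact Finset.sum_congr rfl fun l _ => hW.mul_eq ..
    · intro k _ hk
      exact Finset.sum_eq_zero fun l _ => hW.mul_eq_zero _ _ _ _ _ _ fun h => hk (Fin.ext h)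
    · simp
  map_star' m := by
    simp only [star_sum, hW.star_eq, CStarMatrix.star_apply]
    exact Finset.sum_comm

/-- Multiplying by matrix units on both sides isolates any entry in the corner `(0, 0)`, so
injectivity of `W 0 0` suffices. -/
theorem toHom_injective (hW : IsMatrixSystem W) (N : ℕ) : Function.Injective (hW.toHom N) := by
  rw [injective_iff_map_eq_zero]
  intro m hm
  ext i j
  refine hW.injective ?_
  have h : W 0 i 1 * hW.toHom N m * W j 0 1 = W 0 0 (m i j) := by
    change W 0 i 1 * (∑ k : Fin N, ∑ l : Fin N, W k l (m k l)) * W j 0 1 = _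
    simp only [Finset.mul_sum, Finset.sum_mul]
    rw [Finset.sum_eq_single i, Finset.sum_eq_single j]
    · rw [hW.mul_eq, hW.mul_eq, one_mul, mul_one]
    · intro l _ hl
      rw [mul_assoc, hW.mul_eq_zero _ _ _ _ _ _ (fun h => hl (Fin.ext h)), mul_zero]
    · simp
    · intro k _ hk
      refine Finset.sum_eq_zero fun l _ => ?_
      rw [hW.mul_eq_zero _ _ _ _ _ _ (fun h => hk (Fin.ext h.symm)), zero_mul]
    · simp
  rw [← h, hm]
  simp

theorem matrixSum_eq_toHom (hW : IsMatrixSystem W) {N : ℕ} {f : (ℕ × ℕ) →₀ A}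
    (hf : f.support ⊆ Finset.range N ×ˢ Finset.range N) :
    matrixSum W f = hW.toHom N (CStarMatrix.ofMatrix fun i j => f (i, j)) := by
  change _ = ∑ i : Fin N, ∑ j : Fin N, W i j (f (i, j))
  rw [matrixSum, Finsupp.lsum_apply, Finsupp.sum_of_support_subset _ hf _ (by simp),
    Finset.sum_product, Finset.sum_range]
  exact Finset.sum_congr rfl fun i _ => Finset.sum_range (fun j => W i j (f (i, j)))

/-- Both sides equal the norm of one matrix over `A`, since injective `*`-homomorphisms between
C*-algebras are isometric. -/
theorem norm_matrixSum_eq (hW : IsMatrixSystem W) (hV : IsMatrixSystem V) (f : (ℕ × ℕ) →₀ A) :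
    ‖matrixSum W f‖ = ‖matrixSum V f‖ := by
  obtain ⟨N, hN⟩ : ∃ N, f.support ⊆ Finset.range N ×ˢ Finset.range N := by
    refine ⟨f.support.sup (fun p => p.1 + p.2) + 1, fun p hp => ?_⟩
    have := Finset.le_sup (f := fun p : ℕ × ℕ => p.1 + p.2) hp
    simp only [Finset.mem_product, Finset.mem_range]
    omega
  -- The C*-norm on matrices comes from their action on a Hilbert module over `A`, which refers to
  -- an order on `A`.
  let _ := CStarAlgebra.spectralOrder A
  have := CStarAlgebra.spectralOrderedRing A
  rw [hW.matrixSum_eq_toHom hN, hV.matrixSum_eq_toHom hN,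
    NonUnitalStarAlgHom.norm_map _ (hW.toHom_injective N),
    NonUnitalStarAlgHom.norm_map _ (hV.toHom_injective N)]

/-- The diagonal system in `C × D` maps to both factors; this replaces a direct construction of a
map between the two generated algebras. -/
theorem prod (hW : IsMatrixSystem W) (hV : IsMatrixSystem V) :
    IsMatrixSystem (fun i j => (W i j).prod (V i j)) where
  mul_eq _ _ _ _ _ := Prod.ext (hW.mul_eq ..) (hV.mul_eq ..)
  mul_eq_zero _ _ _ _ _ _ h := Prod.ext (hW.mul_eq_zero _ _ _ _ _ _ h)
    (hV.mul_eq_zero _ _ _ _ _ _ h)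
  star_eq _ _ _ := Prod.ext (hW.star_eq ..) (hV.star_eq ..)
  injective _ _ h := hW.injective (congrArg Prod.fst h)

theorem nonempty_equiv_of_hom (hW : IsMatrixSystem W) (hV : IsMatrixSystem V)
    (φ : C →⋆ₙₐ[ℂ] D) (hφ : ∀ i j a, φ (W i j a) = V i j a) :
    Nonempty (cstarGen (matrixSet W) ≃⋆ₐ[ℂ] cstarGen (matrixSet V)) := by
  have h : φ '' matrixSet W = matrixSet V := by
    ext y
    constructor
    · rintro ⟨_, ⟨i, j, a, rfl⟩, rfl⟩
      exact ⟨i, j, a, hφ i j a⟩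
    · rintro ⟨i, j, a, rfl⟩
      exact ⟨_, ⟨i, j, a, rfl⟩, hφ i j a⟩
  rw [← h]
  refine nonempty_equiv_image φ _ fun x hx => ?_
  obtain ⟨f, rfl⟩ := hW.exists_matrixSum hx
  have : φ (matrixSum W f) = matrixSum V f := by
    simp only [matrixSum, Finsupp.coe_lsum, Finsupp.sum, map_sum, hφ]
  rw [this, hW.norm_matrixSum_eq hV]

/-- Any two matrix systems over `A` generate isomorphic C*-algebras. -/
theorem nonempty_equiv (hW : IsMatrixSystem W) (hV : IsMatrixSystem V)
    {G : NonUnitalStarSubalgebra ℂ D} (hG : cstarGen (matrixSet V) = G) :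
    Nonempty (cstarGen (matrixSet W) ≃⋆ₐ[ℂ] G) := by
  subst hG
  obtain ⟨e⟩ := (hW.prod hV).nonempty_equiv_of_hom hW (NonUnitalStarAlgHom.fst ℂ C D)
    fun _ _ _ => rfl
  obtain ⟨e'⟩ := (hW.prod hV).nonempty_equiv_of_hom hV (NonUnitalStarAlgHom.snd ℂ C D)
    fun _ _ _ => rfl
  exact ⟨e.symm.trans e'⟩

end IsMatrixSystem

end MatrixSystem

universe u v

/-! ### Compact operators as limits of matrix units -/

section Compact

open InnerProductSpace

variable {E : Type*} [NormedAddCommGroup E] [InnerProductSpace ℂ E]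

theorem isCompactOperator_rankOne (x y : E) : IsCompactOperator (rankOne ℂ x y) :=
  (isCompactOperator_of_locallyCompactSpace_dom (innerSL ℂ y)).clm_comp
    (ContinuousLinearMap.toSpanSingleton ℂ x)

variable [CompleteSpace E]

/-- The operator `z ↦ ⟪y, z⟫ x` as an element of the algebra of compact operators. -/
def rankOneOp (x y : E) : compactOps E := ⟨rankOne ℂ x y, isCompactOperator_rankOne x y⟩

theorem rankOneOp_mul_rankOneOp (x y z w : E) :
    rankOneOp x y * rankOneOp z w = inner ℂ y z • rankOneOp x w :=
  Subtype.ext (rankOne_comp_rankOne x y z w)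

theorem star_rankOneOp (x y : E) : star (rankOneOp x y) = rankOneOp y x :=
  Subtype.ext (adjoint_rankOne x y)

/-- The rank-one operator is continuous and (conjugate-)linear in each argument, so the basis
expansions of `y` and then of `x` can be inserted. -/
theorem rankOne_mem_closure_span {ι : Type*} (b : HilbertBasis ι ℂ E) (x y : E) :
    rankOne ℂ x y ∈
      (Submodule.span ℂ {T | ∃ i j, T = rankOne ℂ (b i) (b j)}).topologicalClosure := by
  set V := (Submodule.span ℂ {T | ∃ i j, T = rankOne ℂ (b i) (b j)}).topologicalClosure with hV
  have hcl : IsClosed (V : Set (E →L[ℂ] E)) := Submodule.isClosed_topologicalClosure _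
  have h0 : ∀ i j, rankOne ℂ (b i) (b j) ∈ V := fun i j =>
    Submodule.le_topologicalClosure _ (Submodule.subset_span ⟨i, j, rfl⟩)
  have h1 : ∀ i y, rankOne ℂ (b i) y ∈ V := fun i y => by
    have h := (rankOne ℂ (b i) : E →L⋆[ℂ] (E →L[ℂ] E)).hasSum (b.hasSum_repr y)
    refine hcl.mem_of_tendsto h (Filter.Eventually.of_forall fun t => V.sum_mem fun j _ => ?_)
    rw [ContinuousLinearMap.map_smulₛₗ]
    exact V.smul_mem _ (h0 i j)
  have h := ((rankOne ℂ : E →L[ℂ] E →L⋆[ℂ] (E →L[ℂ] E)).flip y).hasSum (b.hasSum_repr x)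
  refine hcl.mem_of_tendsto h (Filter.Eventually.of_forall fun t => V.sum_mem fun j _ => ?_)
  rw [ContinuousLinearMap.map_smulₛₗ]
  exact V.smul_mem _ (h1 j y)

/-- Compact operators on a Hilbert space are limits of finite rank operators. -/
theorem mem_closure_span_rankOne {T : E →L[ℂ] E} (hT : IsCompactOperator T) :
    T ∈ (Submodule.span ℂ {S : E →L[ℂ] E | ∃ x y, S = rankOne ℂ x y}).topologicalClosure := by
  change T ∈ closure _
  rw [Metric.mem_closure_iff]
  intro ε hε
  have htb : TotallyBounded (T '' Metric.closedBall 0 1) :=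
    (IsCompactOperator.isCompact_closure_image_closedBall (f := (T : E →ₗ[ℂ] E)) hT
      1).totallyBounded.subset subset_closure
  obtain ⟨t, htf, hcov⟩ := Metric.totallyBounded_iff.1 htb (ε / 2) (by positivity)
  let F : Submodule ℂ E := Submodule.span ℂ t
  have : FiniteDimensional ℂ F := FiniteDimensional.span_of_finite ℂ htf
  -- `F` is spanned by a finite `ε/2`-net of the image of the unit ball. Projecting `T x` to `F`
  -- moves it no further than its distance to the net.
  refine ⟨F.starProjection * T, ?_, ?_⟩
  · let b := stdOrthonormalBasis ℂ F
    rw [b.starProjection_eq_sum_rankOne, Finset.sum_mul]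
    refine Submodule.sum_mem _ fun i _ => Submodule.subset_span ⟨b i, star T (b i), ?_⟩
    exact rankOne_comp _ _ _
  · rw [dist_eq_norm]
    refine lt_of_le_of_lt (ContinuousLinearMap.opNorm_le_of_unit_norm (C := ε / 2)
      (by positivity) fun x hx => ?_) (half_lt_self hε)
    have hx' := hcov ⟨x, by simp [hx], rfl⟩
    simp only [Set.mem_iUnion, Metric.mem_ball, exists_prop, dist_eq_norm] at hx'
    obtain ⟨y, hy, hxy⟩ := hx'
    change ‖T x - F.starProjection (T x)‖ ≤ ε / 2
    rw [Submodule.starProjection_minimal]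
    refine (ciInf_le ⟨0, ?_⟩ (⟨y, Submodule.subset_span hy⟩ : F)).trans hxy.le
    rintro _ ⟨z, rfl⟩
    exact norm_nonneg _

theorem mem_closure_span_rankOneOp {ι : Type*} (b : HilbertBasis ι ℂ E) (T : compactOps E) :
    T ∈ closure (Submodule.span ℂ {S | ∃ i j, S = rankOneOp (b i) (b j)} : Set (compactOps E)) := by
  rw [closure_subtype]
  have h : (Subtype.val '' (Submodule.span ℂ {S | ∃ i j, S = rankOneOp (b i) (b j)} :
      Set (compactOps E))) =
      (Submodule.span ℂ {T | ∃ i j, T = rankOne ℂ (b i) (b j)} : Set (E →L[ℂ] E)) := by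
    have h1 := Submodule.map_span (compactOps E).toSubmodule.subtype
      {S | ∃ i j, S = rankOneOp (b i) (b j)}
    have h2 : (compactOps E).toSubmodule.subtype '' {S | ∃ i j, S = rankOneOp (b i) (b j)} =
        {T | ∃ i j, T = rankOne ℂ (b i) (b j)} := by
      ext S
      constructor
      · rintro ⟨_, ⟨i, j, rfl⟩, rfl⟩
        exact ⟨i, j, rfl⟩
      · rintro ⟨i, j, rfl⟩
        exact ⟨_, ⟨i, j, rfl⟩, rfl⟩
    rw [h2] at h1
    rw [← h1]
    rfl
  rw [h]
  have h3 : Submodule.span ℂ {S : E →L[ℂ] E | ∃ x y, S = rankOne ℂ x y} ≤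
      (Submodule.span ℂ {T | ∃ i j, T = rankOne ℂ (b i) (b j)}).topologicalClosure := by
    rw [Submodule.span_le]
    rintro _ ⟨x, y, rfl⟩
    exact rankOne_mem_closure_span b x y
  exact Submodule.topologicalClosure_minimal _ h3 (Submodule.isClosed_topologicalClosure _)
    (mem_closure_span_rankOne T.2)

theorem exists_hilbertBasis_nat [TopologicalSpace.SeparableSpace E]
    (hE : ¬ FiniteDimensional ℂ E) : Nonempty (HilbertBasis ℕ ℂ E) := by
  obtain ⟨w, b, -⟩ := exists_hilbertBasis ℂ E
  have hinf : Infinite w := by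
    by_contra h
    rw [not_infinite_iff_finite] at h
    have := Fintype.ofFinite w
    exact hE b.toOrthonormalBasis.toBasis.finiteDimensional_of_finite
  have hcount : Countable w := by
    -- Orthonormal vectors are `√2` apart; the bound `1` already makes the balls of radius `1/2`
    -- disjoint, and a separable space has only countably many disjoint nonempty open sets.
    have hd : Pairwise fun i j => 1 ≤ dist (b i) (b j) := fun i j hij => by
      have h1 : ‖b i - b j‖ ^ 2 = 2 := by
        rw [@norm_sub_sq ℂ, b.orthonormal.norm_eq_one, b.orthonormal.norm_eq_one,
          b.orthonormal.inner_eq_zero hij]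
        norm_num
      change 1 ≤ dist (b i) (b j)
      rw [dist_eq_norm]
      nlinarith [norm_nonneg (b i - b j)]
    refine Set.PairwiseDisjoint.countable_of_isOpen (s := fun i => Metric.ball (b i) (1 / 2))
      (a := Set.univ) ?_ (fun _ _ => Metric.isOpen_ball)
      (fun i _ => ⟨b i, by simp⟩) |> Set.countable_univ_iff.1
    intro i _ j _ hij
    refine Metric.ball_disjoint_ball ?_
    have h1 : 1 ≤ dist (b i) (b j) := hd hij
    linarith
  obtain ⟨e⟩ := nonempty_equiv_of_countable (α := w) (β := ℕ)
  refine ⟨HilbertBasis.mk (b.orthonormal.comp e.symm e.symm.injective) ?_⟩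
  rw [e.symm.surjective.range_comp, b.dense_span]

end Compact

/-! ### Elementary tensors -/

section Tensor

variable {A : Type u} {B : Type v} [NonUnitalCStarAlgebra A] [NonUnitalCStarAlgebra B]

theorem tmul_mul_tmul (a a' : A) (b b' : B) : tmul a b * tmul a' b' = tmul (a * a') (b * b') := by
  ext1
  funext P
  change P.π a * P.ρ b * (P.π a' * P.ρ b') = P.π (a * a') * P.ρ (b * b')
  rw [map_mul, map_mul, mul_assoc, ← mul_assoc (P.ρ b), ← (P.commute a' b).eq]
  simp only [mul_assoc]

theorem star_tmul (a : A) (b : B) : star (tmul a b) = tmul (star a) (star b) := by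
  ext1
  funext P
  change star (P.π a * P.ρ b) = P.π (star a) * P.ρ (star b)
  rw [star_mul, (P.commute (star a) (star b)).eq, map_star, map_star]

/-- The elementary tensors with a fixed second factor, as a linear map. -/
def tmulLeft (b : B) : A →ₗ[ℂ] CommutingReps.Prod A B where
  toFun a := tmul a b
  map_add' a a' := by
    ext1
    funext P
    change P.π (a + a') * P.ρ b = P.π a * P.ρ b + P.π a' * P.ρ b
    rw [map_add, add_mul]
  map_smul' c a := by
    ext1
    funext P
    change P.π (c • a) * P.ρ b = c • (P.π a * P.ρ b)
    rw [map_smul, smul_mul_assoc]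

/-- The elementary tensors with a fixed first factor, as a continuous linear map. -/
def tmulRight (a : A) : B →L[ℂ] CommutingReps.Prod A B :=
  LinearMap.mkContinuous
    { toFun := fun b => tmul a b
      map_add' := fun b b' => by
        ext1
        funext P
        change P.π a * P.ρ (b + b') = P.π a * P.ρ b + P.π a * P.ρ b'
        rw [map_add, mul_add]
      map_smul' := fun c b => by
        ext1
        funext P
        change P.π a * P.ρ (c • b) = c • (P.π a * P.ρ b)
        rw [map_smul, mul_smul_comm] }
    ‖a‖ fun b => by
      refine lp.norm_le_of_forall_le (by positivity) fun P => ?_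
      exact (norm_mul_le _ _).trans (mul_le_mul (NonUnitalStarAlgHom.norm_apply_le P.π a)
        (NonUnitalStarAlgHom.norm_apply_le P.ρ b) (norm_nonneg _) (norm_nonneg _))

theorem tmul_mem_of_mem_closure_span (a : A) {S : Set B} {T : B}
    (hT : T ∈ closure (Submodule.span ℂ S : Set B)) 
    {G : NonUnitalStarSubalgebra ℂ (CommutingReps.Prod A B)}
    (hG : IsClosed (G : Set (CommutingReps.Prod A B))) (h : ∀ b ∈ S, tmul a b ∈ G) :
    tmul a T ∈ G := by
  have h1 : Submodule.span ℂ S ≤ G.toSubmodule.comap (tmulRight a : B →L[ℂ] _).toLinearMap :=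
    Submodule.span_le.2 h
  exact closure_minimal h1 (hG.preimage (tmulRight a : B →L[ℂ] _).continuous) hT

end Tensor

/-! ### The tensor product with the compact operators as a matrix system -/

section TensorCompact

variable {A : Type} [CStarAlgebra A] {E : Type v} [NormedAddCommGroup E]
  [InnerProductSpace ℂ E] [CompleteSpace E]

/-- The commuting representations of `A` and `𝒦(E)` on `E` given by a character of `A`. -/
def characterReps (χ : A →⋆ₙₐ[ℂ] ℂ) : CommutingReps A (compactOps E) where
  H := E
  π :=
    { toFun := fun a => χ a • (1 : E →L[ℂ] E)
      map_smul' := fun c a => by simp [mul_smul]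
      map_zero' := by simp
      map_add' := fun a b => by simp [add_smul]
      map_mul' := fun a b => by simp [smul_smul, mul_comm]
      map_star' := fun a => by simp [map_star χ a] }
  ρ := NonUnitalStarSubalgebraClass.subtype (compactOps E)
  commute _ _ := (Commute.one_left _).smul_left _

/-- Injectivity needs only that characters separate the points of `A`: each character gives a
commuting pair of representations on `E` in which `a ⊗ e₀₀` acts as `χ(a) e₀₀`. -/
theorem isMatrixSystem_tmul (hA : ∀ a : A, a ≠ 0 → ∃ χ : A →⋆ₙₐ[ℂ] ℂ, χ a ≠ 0)
    (b : HilbertBasis ℕ ℂ E) :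
    IsMatrixSystem (fun i j => tmulLeft (A := A) (rankOneOp (b i) (b j))) where
  mul_eq i j k a a' := by
    change tmul _ _ * tmul _ _ = tmul _ _
    rw [tmul_mul_tmul, rankOneOp_mul_rankOneOp, inner_self_eq_norm_sq_to_K,
      b.orthonormal.norm_eq_one]
    simp
  mul_eq_zero i j k l a a' h := by
    change tmul _ _ * tmul _ _ = _
    rw [tmul_mul_tmul, rankOneOp_mul_rankOneOp, b.orthonormal.inner_eq_zero h, zero_smul]
    exact map_zero (tmulRight (a * a'))
  star_eq i j a := by
    change star (tmul _ _) = tmul _ _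
    rw [star_tmul, star_rankOneOp]
  injective := by
    rw [injective_iff_map_eq_zero]
    intro a ha
    by_contra h
    obtain ⟨χ, hχ⟩ := hA a h
    have h1 : (χ a • (1 : E →L[ℂ] E)) * InnerProductSpace.rankOne ℂ (b 0) (b 0) = 0 :=
      congrArg (fun t : CommutingReps.Prod A (compactOps E) => t (characterReps χ)) ha
    have h2 := b.orthonormal.ne_zero 0
    rw [smul_mul_assoc, one_mul, smul_eq_zero, InnerProductSpace.rankOne_eq_zero] at h1
    tauto

theorem cstarGen_tmul (b : HilbertBasis ℕ ℂ E) :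
    cstarGen (matrixSet fun i j => tmulLeft (A := A) (rankOneOp (b i) (b j))) =
      tensorSubalgebra A (compactOps E) := by
  refine cstarGen_eq ?_ ?_
  · rintro _ ⟨i, j, a, rfl⟩
    exact subset_cstarGen _ ⟨a, _, rfl⟩
  · rintro _ ⟨a, T, rfl⟩
    refine tmul_mem_of_mem_closure_span a (mem_closure_span_rankOneOp b T)
      (isClosed_cstarGen _) ?_
    rintro _ ⟨i, j, rfl⟩
    have h : tmul a (rankOneOp (b i) (b j)) ∈
        matrixSet fun i j => tmulLeft (A := A) (rankOneOp (b i) (b j)) := ⟨i, j, a, rfl⟩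
    exact subset_cstarGen _ h

/-- The C*-algebra generated by a matrix system over `A` is `A ⊗ 𝒦`. -/
theorem IsMatrixSystem.nonempty_equiv_tensor {C : Type*} [NonUnitalCStarAlgebra C]
    {W : ℕ → ℕ → A →ₗ[ℂ] C} (hW : IsMatrixSystem W) [TopologicalSpace.SeparableSpace E]
    (hE : ¬ FiniteDimensional ℂ E) (hA : ∀ a : A, a ≠ 0 → ∃ χ : A →⋆ₙₐ[ℂ] ℂ, χ a ≠ 0) :
    Nonempty (cstarGen (matrixSet W) ≃⋆ₐ[ℂ] CStarTensor A (compactOps E)) := by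
  obtain ⟨b⟩ := exists_hilbertBasis_nat hE
  exact hW.nonempty_equiv (isMatrixSystem_tmul hA b) (cstarGen_tmul b)

end TensorCompact

/-! ### Isometries that intertwine a representation -/

section Shift

variable {A B : Type*} [CStarAlgebra A] [CStarAlgebra B]

/-- An isometry `u` and a representation `μ` of `A` with `μ a * u = u * μ (τ a)`, where `τ` is
onto, such that the compression of `μ` to the kernel of `u*` is faithful. -/
structure IsShiftRep (u : B) (μ : A →⋆ₐ[ℂ] B) (τ : A → A) : Prop where
  isometry : star u * u = 1
  intertwine : ∀ a, μ a * u = u * μ (τ a)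
  surjective : Function.Surjective τ
  faithful : ∀ a, μ a * (1 - u * star u) = 0 → a = 0

namespace IsShiftRep

variable {u : B} {μ : A →⋆ₐ[ℂ] B} {τ : A → A}

theorem star_mul_proj (h : IsShiftRep u μ τ) : star u * (1 - u * star u) = 0 := by
  rw [mul_sub, ← mul_assoc, h.isometry, mul_one, one_mul, sub_self]

theorem proj_mul (h : IsShiftRep u μ τ) : (1 - u * star u) * u = 0 := by
  rw [sub_mul, mul_assoc, h.isometry, mul_one, one_mul, sub_self]

theorem proj_mul_proj (h : IsShiftRep u μ τ) :
    (1 - u * star u) * (1 - u * star u) = 1 - u * star u := by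
  rw [mul_sub, ← mul_assoc, h.proj_mul, zero_mul, mul_one, sub_zero]

theorem star_proj : star (1 - u * star u) = 1 - u * star u := by simp

theorem star_pow_mul_pow (h : IsShiftRep u μ τ) (j : ℕ) : star u ^ j * u ^ j = 1 := by
  induction j with
  | zero => simp
  | succ j ih =>
    rw [pow_succ, pow_succ', mul_assoc, ← mul_assoc (star u), h.isometry, one_mul, ih]

/-- This is the adjoint of `intertwine` at `star a`. No compatibility of `τ` with `star` is assumed;
it is recovered from the compression `u* μ(a) u = μ(τ a)`. -/
theorem star_mul_rep (h : IsShiftRep u μ τ) (a : A) : star u * μ a = μ (τ a) * star u := by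
  have h1 : ∀ a, star u * μ a * u = μ (τ a) := fun a => by
    rw [mul_assoc, h.intertwine, ← mul_assoc, h.isometry, one_mul]
  have h2 := congrArg star (h.intertwine (star a))
  rw [star_mul, star_mul, ← map_star, star_star, ← h1, star_mul, star_mul, star_star,
    ← map_star, star_star, ← mul_assoc, h1] at h2
  exact h2

theorem rep_mul_proj (h : IsShiftRep u μ τ) (a : A) :
    μ a * (1 - u * star u) = (1 - u * star u) * μ a := by
  rw [mul_sub, sub_mul, mul_one, one_mul, ← mul_assoc, h.intertwine, mul_assoc, mul_assoc,
    h.star_mul_rep]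

theorem rep_mul_pow (h : IsShiftRep u μ τ) (i : ℕ) (a : A) :
    μ a * u ^ i = u ^ i * μ (τ^[i] a) := by
  induction i generalizing a with
  | zero => simp
  | succ i ih => rw [pow_succ', ← mul_assoc, h.intertwine, mul_assoc, ih, ← mul_assoc,
      Function.iterate_succ_apply]

variable (u μ) in
/-- The matrix units `uⁱ μ(a) (1 - uu*) (u*)ʲ`. -/
def unitMap (i j : ℕ) : A →ₗ[ℂ] B where
  toFun a := u ^ i * (μ a * (1 - u * star u)) * star u ^ j
  map_add' a b := by rw [map_add, add_mul, mul_add, add_mul]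
  map_smul' c a := by
    rw [map_smul, smul_mul_assoc, mul_smul_comm, smul_mul_assoc, RingHom.id_apply]

theorem unitMap_apply (i j : ℕ) (a : A) :
    unitMap u μ i j a = u ^ i * (μ a * (1 - u * star u)) * star u ^ j := rfl

theorem isMatrixSystem (h : IsShiftRep u μ τ) : IsMatrixSystem (unitMap u μ) where
  mul_eq i j k a b := by
    calc u ^ i * (μ a * (1 - u * star u)) * star u ^ j * (u ^ j * (μ b * (1 - u * star u)) *
          star u ^ k)
        = u ^ i * (μ a * (1 - u * star u)) * (star u ^ j * u ^ j) * (μ b * (1 - u * star u)) *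
          star u ^ k := by simp only [mul_assoc]
      _ = u ^ i * (μ a * ((1 - u * star u) * (μ b * (1 - u * star u)))) * star u ^ k := by
        rw [h.star_pow_mul_pow, mul_one]
        simp only [mul_assoc]
      _ = u ^ i * (μ (a * b) * (1 - u * star u)) * star u ^ k := by
        rw [← mul_assoc (1 - u * star u), ← h.rep_mul_proj, mul_assoc (μ b), h.proj_mul_proj, map_mul,
          mul_assoc (μ a)]
  mul_eq_zero i j k l a b hjk := by
    -- After cancellation a positive power of `u` (if `j < k`) or of `u*` (if `j > k`) meets the
    -- projection, which kills it.
    have key : (1 - u * star u) * (star u ^ j * u ^ k) * (1 - u * star u) = 0 := by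
      rcases lt_or_gt_of_ne hjk with hlt | hlt
      · obtain ⟨d, rfl⟩ := Nat.exists_eq_add_of_lt hlt
        rw [add_assoc, pow_add, ← mul_assoc (star u ^ j), h.star_pow_mul_pow, one_mul, pow_succ',
          ← mul_assoc, h.proj_mul, zero_mul, zero_mul]
      · obtain ⟨d, rfl⟩ := Nat.exists_eq_add_of_lt hlt
        rw [add_assoc, add_comm, pow_add, mul_assoc (star u ^ (d + 1)), h.star_pow_mul_pow,
          mul_one, pow_succ, mul_assoc, mul_assoc, h.star_mul_proj, mul_zero, mul_zero]
    calc u ^ i * (μ a * (1 - u * star u)) * star u ^ j * (u ^ k * (μ b * (1 - u * star u)) *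
          star u ^ l)
        = u ^ i * (μ a * (1 - u * star u)) * star u ^ j * (u ^ k * ((1 - u * star u) * μ b) *
          star u ^ l) := by rw [h.rep_mul_proj b]
      _ = u ^ i * μ a * ((1 - u * star u) * (star u ^ j * u ^ k) * (1 - u * star u)) * μ b *
          star u ^ l := by simp only [mul_assoc]
      _ = 0 := by rw [key, mul_zero, zero_mul, zero_mul]
  star_eq i j a := by
    simp only [unitMap_apply, star_mul, star_pow, star_star, ← map_star]
    rw [star_proj, ← h.rep_mul_proj]
    simp only [mul_assoc]
  injective := by
    rw [injective_iff_map_eq_zero]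
    intro a ha
    exact h.faithful a (by simpa [unitMap_apply] using ha)

theorem mul_unitMap (i j : ℕ) (a : A) : u * unitMap u μ i j a = unitMap u μ (i + 1) j a := by
  simp only [unitMap_apply, pow_succ', mul_assoc]

theorem star_mul_unitMap_succ (h : IsShiftRep u μ τ) (i j : ℕ) (a : A) :
    star u * unitMap u μ (i + 1) j a = unitMap u μ i j a := by
  rw [← mul_unitMap, ← mul_assoc, h.isometry, one_mul]

theorem star_mul_unitMap_zero (h : IsShiftRep u μ τ) (j : ℕ) (a : A) :
    star u * unitMap u μ 0 j a = 0 := by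
  rw [unitMap_apply, pow_zero, one_mul, h.rep_mul_proj, ← mul_assoc, ← mul_assoc,
    h.star_mul_proj, zero_mul, zero_mul]

theorem rep_mul_unitMap (h : IsShiftRep u μ τ) (i j : ℕ) (a b : A) :
    μ b * unitMap u μ i j a = unitMap u μ i j (τ^[i] b * a) := by
  rw [unitMap_apply, unitMap_apply, ← mul_assoc, ← mul_assoc, h.rep_mul_pow, map_mul]
  simp only [mul_assoc]

theorem rep_mul_conj_proj (h : IsShiftRep u μ τ) (k : ℕ) (a : A) :
    μ a * (u ^ k * (1 - u * star u) * star u ^ k) = unitMap u μ k k (τ^[k] a) := by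
  rw [← mul_assoc, ← mul_assoc, h.rep_mul_pow, unitMap_apply]
  simp only [mul_assoc]

theorem conj_proj_mul_rep (h : IsShiftRep u μ τ) (k : ℕ) (a : A) :
    (u ^ k * (1 - u * star u) * star u ^ k) * μ a =
      μ a * (u ^ k * (1 - u * star u) * star u ^ k) := by
  have h1 : star u ^ k * μ a = μ (τ^[k] a) * star u ^ k := by
    induction k generalizing a with
    | zero => simp
    | succ k ih => rw [pow_succ, mul_assoc, h.star_mul_rep, ← mul_assoc, ih, mul_assoc,
        Function.iterate_succ_apply]
  rw [h.rep_mul_conj_proj, unitMap_apply, mul_assoc, h1, h.rep_mul_proj]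
  simp only [mul_assoc]

/-- The algebra generated by the matrix units is a two-sided ideal for every algebra whose
generators multiply the matrix units into it. -/
theorem mul_mem_of_generators (h : IsShiftRep u μ τ) {T : Set B}
    (hT : ∀ t ∈ T, ∀ i j a, t * unitMap u μ i j a ∈ cstarGen (matrixSet (unitMap u μ)) ∧
      star t * unitMap u μ i j a ∈ cstarGen (matrixSet (unitMap u μ)))
    {c : B} (hc : c ∈ cstarGen T) {x : B} (hx : x ∈ cstarGen (matrixSet (unitMap u μ))) :
    c * x ∈ cstarGen (matrixSet (unitMap u μ)) ∧ x * c ∈ cstarGen (matrixSet (unitMap u μ)) := by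
  set G := cstarGen (matrixSet (unitMap u μ)) with hG
  have hGc : IsClosed (G : Set B) := isClosed_cstarGen _
  have hleft : ∀ t, (∀ i j a, t * unitMap u μ i j a ∈ G) → ∀ x ∈ G, t * x ∈ G := by
    intro t ht x hx
    have hx' : x ∈ closure (Submodule.span ℂ (matrixSet (unitMap u μ)) : Set B) := by
      rw [← h.isMatrixSystem.cstarGen_eq_closure]
      exact hx
    have h1 : Submodule.span ℂ (matrixSet (unitMap u μ)) ≤
        G.toSubmodule.comap (LinearMap.mulLeft ℂ t) := by
      rw [Submodule.span_le]
      rintro _ ⟨i, j, a, rfl⟩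
      exact ht i j a
    exact closure_minimal h1 (hGc.preimage (continuous_const_mul t)) hx'
  -- The elements that multiply `G` into itself from both sides form a closed `*`-algebra, so only
  -- the generators have to be tested.
  let L : NonUnitalStarSubalgebra ℂ B :=
    { carrier := {c | ∀ x ∈ G, c * x ∈ G ∧ x * c ∈ G}
      add_mem' := fun ha hb x hx => by
        rw [add_mul, mul_add]
        exact ⟨add_mem (ha x hx).1 (hb x hx).1, add_mem (ha x hx).2 (hb x hx).2⟩
      zero_mem' := fun x _ => by simp [zero_mem]
      mul_mem' := fun {a b} ha hb x hx => by
        rw [mul_assoc, ← mul_assoc x]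
        exact ⟨(ha _ (hb x hx).1).1, (hb _ (ha x hx).2).2⟩
      smul_mem' := fun r a ha x hx => by
        rw [smul_mul_assoc, mul_smul_comm]
        exact ⟨SMulMemClass.smul_mem r (ha x hx).1, SMulMemClass.smul_mem r (ha x hx).2⟩
      star_mem' := fun {a} ha x hx => by
        have h1 := ha (star x) (star_mem hx)
        exact ⟨by simpa using star_mem h1.2, by simpa using star_mem h1.1⟩ }
  have hLc : IsClosed (L : Set B) := by
    have : (L : Set B) = ⋂ x ∈ G, {c | c * x ∈ (G : Set B)} ∩ {c | x * c ∈ (G : Set B)} := by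
      ext c
      simp only [Set.mem_iInter]
      rfl
    rw [this]
    exact isClosed_biInter fun x _ => (hGc.preimage (continuous_mul_const x)).inter
      (hGc.preimage (continuous_const_mul x))
  have hTL : T ⊆ L := fun t ht x hx =>
    ⟨hleft t (fun i j a => (hT t ht i j a).1) x hx, by
      simpa using star_mem (hleft (star t) (fun i j a => (hT t ht i j a).2) _ (star_mem hx))⟩
  exact cstarGen_le hTL hLc hc x hx

theorem unitMap_mem (i j : ℕ) (a : A) : unitMap u μ i j a ∈ cstarGen (matrixSet (unitMap u μ)) :=
  subset_cstarGen _ ⟨i, j, a, rfl⟩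

theorem generators_mul_mem (h : IsShiftRep u μ τ) (S : Set A) :
    ∀ t ∈ {u} ∪ μ '' S, ∀ i j a, t * unitMap u μ i j a ∈ cstarGen (matrixSet (unitMap u μ)) ∧
      star t * unitMap u μ i j a ∈ cstarGen (matrixSet (unitMap u μ)) := by
  rintro t (rfl | ⟨b, -, rfl⟩) i j a
  · rw [mul_unitMap]
    refine ⟨unitMap_mem _ _ _, ?_⟩
    cases i with
    | zero => rw [h.star_mul_unitMap_zero]; exact zero_mem _
    | succ i => rw [h.star_mul_unitMap_succ]; exact unitMap_mem _ _ _
  · rw [← map_star, h.rep_mul_unitMap, h.rep_mul_unitMap]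
    exact ⟨unitMap_mem _ _ _, unitMap_mem _ _ _⟩

theorem rep_mem {S : Set A} (hS : Submodule.span ℂ S = ⊤) (a : A) :
    μ a ∈ cstarGen ({u} ∪ μ '' S) := by
  have h1 : Submodule.span ℂ S ≤ (cstarGen ({u} ∪ μ '' S)).toSubmodule.comap
      (μ : A →ₐ[ℂ] B).toLinearMap := by
    rw [Submodule.span_le]
    exact fun b hb => subset_cstarGen _ (Or.inr ⟨b, hb, rfl⟩)
  rw [hS] at h1
  exact h1 (Submodule.mem_top (x := a))

theorem isIdealOf (h : IsShiftRep u μ τ) {S : Set A} (hS : Submodule.span ℂ S = ⊤) :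
    IsIdealOf (cstarGen (matrixSet (unitMap u μ))) (cstarGen ({u} ∪ μ '' S)) := by
  refine ⟨cstarGen_le ?_ (isClosed_cstarGen _), fun x hx c hc =>
    h.mul_mem_of_generators (h.generators_mul_mem S) hc hx⟩
  -- The generated algebra is not unital by definition; its unit comes from `μ 1`.
  have h1 : (1 : B) ∈ cstarGen ({u} ∪ μ '' S) := by
    rw [← map_one μ]
    exact rep_mem hS 1
  have hpow : ∀ {y : B}, y ∈ cstarGen ({u} ∪ μ '' S) → ∀ k : ℕ,
      y ^ k ∈ cstarGen ({u} ∪ μ '' S) := fun {y} hy k => by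
    induction k with
    | zero => rwa [pow_zero]
    | succ k ih => rw [pow_succ]; exact mul_mem ih hy
  have hu : u ∈ cstarGen ({u} ∪ μ '' S) := subset_cstarGen _ (Or.inl rfl)
  rintro _ ⟨i, j, a, rfl⟩
  exact mul_mem (mul_mem (hpow hu i) (mul_mem (rep_mem hS a)
    (sub_mem h1 (mul_mem hu (star_mem hu))))) (hpow (star_mem hu) j)

/-- A spanning set `S` suffices for the coefficients, which covers both all of `C(ℤ_s)` and the
indicator functions at level `n`. -/
theorem cstarGen_matrixSet (h : IsShiftRep u μ τ) {S : Set A} (hS : Submodule.span ℂ S = ⊤) :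
    cstarGen {T | ∃ x ∈ cstarGen {T | ∃ a ∈ S, ∃ k : ℕ,
      T = μ a * (u ^ k * (1 - u * star u) * star u ^ k)}, ∃ m : ℕ, T = x * u ^ m} =
      cstarGen (matrixSet (unitMap u μ)) := by
  set K := cstarGen {T | ∃ a ∈ S, ∃ k : ℕ, T = μ a * (u ^ k * (1 - u * star u) * star u ^ k)}
    with hK
  refine cstarGen_eq ?_ ?_
  · rintro _ ⟨x, hx, m, rfl⟩
    have hx' : x ∈ cstarGen (matrixSet (unitMap u μ)) := by
      refine cstarGen_le ?_ (isClosed_cstarGen _) hx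
      rintro _ ⟨a, -, k, rfl⟩
      rw [h.rep_mul_conj_proj]
      exact unitMap_mem _ _ _
    induction m with
    | zero => rwa [pow_zero, mul_one]
    | succ m ih =>
      rw [pow_succ, ← mul_assoc]
      exact (h.mul_mem_of_generators (h.generators_mul_mem S)
        (subset_cstarGen _ (Or.inl rfl)) ih).2
  · have hdiag : ∀ k a, unitMap u μ k k a ∈ K := fun k a => by
      -- Surjectivity of `τ` enters here: `μ b` times the `k`-th projection has coefficient `τᵏ b`,
      -- and every `a` must occur.
      obtain ⟨b, rfl⟩ := h.surjective.iterate k a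
      rw [← h.rep_mul_conj_proj]
      have h1 : Submodule.span ℂ S ≤ K.toSubmodule.comap
          ((LinearMap.mulRight ℂ (u ^ k * (1 - u * star u) * star u ^ k)).comp
            (μ : A →ₐ[ℂ] B).toLinearMap) := by
        rw [Submodule.span_le]
        exact fun b hb => subset_cstarGen _ ⟨b, hb, k, rfl⟩
      rw [hS] at h1
      exact h1 (Submodule.mem_top (x := b))
    have hlower : ∀ j d a, unitMap u μ (j + d) j a ∈
        cstarGen {T | ∃ x ∈ K, ∃ m : ℕ, T = x * u ^ m} := fun j d a => by
      refine subset_cstarGen _ ⟨_, hdiag (j + d) a, d, ?_⟩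
      rw [unitMap_apply, unitMap_apply, mul_assoc _ _ (u ^ d), pow_add (star u), mul_assoc _ _ (u ^ d),
        h.star_pow_mul_pow, mul_one]
    rintro _ ⟨i, j, a, rfl⟩
    rcases le_total j i with hji | hij
    · obtain ⟨d, rfl⟩ := Nat.exists_eq_add_of_le hji
      exact hlower j d a
    -- Entries above the diagonal are adjoints of entries below it.
    · obtain ⟨d, rfl⟩ := Nat.exists_eq_add_of_le hij
      have := star_mem (hlower i d (star a))
      rwa [h.isMatrixSystem.star_eq, star_star] at this

end IsShiftRep

end Shift

theorem span_range_single (m : ℕ) :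
    Submodule.span ℂ (Set.range fun c : Fin m => (Pi.single c 1 : Fin m → ℂ)) = ⊤ := by
  rw [← (Pi.basisFun ℂ (Fin m)).span_eq]
  congr 2
  ext1 c
  exact (Pi.basisFun_apply ℂ _ c).symm

/-! ### Congruences and density in the `s`-adic integers -/

section Integers

variable {s : ℕ}

theorem natCast_apply (y n : ℕ) : ((y : Zs s) : ∀ n, ZMod (s ^ n)) n = y := by
  rw [SubringClass.coe_natCast, Pi.natCast_apply]

theorem castHom_apply_eq (x : Zs s) {m n : ℕ} (h : m ≤ n) :
    ZMod.castHom (pow_dvd_pow s h) (ZMod (s ^ m)) ((x : ∀ n, ZMod (s ^ n)) n) =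
      (x : ∀ n, ZMod (s ^ n)) m :=
  x.2 m n h

/-- Balls of radius `s⁻ⁿ` are thus residue classes modulo `sⁿ`. -/
theorem sabs_le_iff [s.AtLeastTwo] (x : Zs s) (n : ℕ) :
    sabs s x ≤ ((s : ℝ) ^ n)⁻¹ ↔ (x : ∀ n, ZMod (s ^ n)) n = 0 := by
  classical
  have hs : 2 ≤ s := Nat.AtLeastTwo.prop
  have hs1 : (1 : ℝ) < s := by exact_mod_cast hs
  have h0 : (x : ∀ n, ZMod (s ^ n)) 0 = 0 := by
    have : Subsingleton (ZMod (s ^ 0)) := by rw [pow_zero]; infer_instance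
    exact Subsingleton.elim _ _
  unfold sabs
  split_ifs with h
  · rw [inv_le_inv₀ (by positivity) (by positivity), pow_le_pow_iff_right₀ hs1, Nat.le_find_iff]
    constructor
    · intro hn
      rcases n with _ | k
      · exact h0
      · simpa using hn k k.lt_succ_self
    · intro hn m hm
      rw [not_not, ← castHom_apply_eq x hm, hn, map_zero]
  · push Not at h
    refine ⟨fun _ => ?_, fun _ => by positivity⟩
    rcases n with _ | k
    · exact h0
    · exact h k

/-- If `f` vanishes at the integers `y` which label balls outside the range of the shift, then
`f = 0`. -/
theorem eq_zero_of_forall_initial [s.AtLeastTwo] (f : C(Zs s, ℂ))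
    (hf : ∀ b : Ball s, b ∉ Set.range (next s) → f ((b.2 : ℕ) : Zs s) = 0) : f = 0 := by
  have hs : 2 ≤ s := Nat.AtLeastTwo.prop
  ext x
  let v : ℕ → ℕ := fun j => ((x : ∀ n, ZMod (s ^ n)) j).val
  -- In level `j + 1` the range of `next` consists of the labels `1, …, sʲ`. Adding `sʲ` to a
  -- nonzero residue leaves this range without changing it modulo `sʲ`. Residue `0` stays put, as
  -- `sʲ` itself would lie in the range.
  let y : ℕ → ℕ := fun j => if v j = 0 then 0 else v j + s ^ j
  have hv : ∀ j, v j < s ^ j := fun j => ZMod.val_lt _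
  have hylt : ∀ j, y j < s ^ (j + 1) := fun j => by
    have h1 : s ^ j * 2 ≤ s ^ (j + 1) := by
      rw [pow_succ]
      exact Nat.mul_le_mul_left _ hs
    have := hv j
    simp only [y]
    split_ifs
    · positivity
    · omega
  have hy0 : ∀ j, f ((y j : ℕ) : Zs s) = 0 := fun j => by
    refine hf ⟨j + 1, ⟨y j, hylt j⟩⟩ ?_
    rintro ⟨⟨m, c⟩, hc⟩
    simp only [next, Sigma.mk.injEq] at hc
    obtain ⟨h1, h2⟩ := hc
    obtain rfl : m = j := by omega
    simp only [heq_eq_eq, Fin.mk.injEq] at h2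
    have h3 := c.isLt
    simp only [y] at h2
    split_ifs at h2
    omega
  have hyx : ∀ j, ((y j : Zs s) : ∀ n, ZMod (s ^ n)) j = (x : ∀ n, ZMod (s ^ n)) j := fun j => by
    have h1 : ((v j : ℕ) : ZMod (s ^ j)) = (x : ∀ n, ZMod (s ^ n)) j := ZMod.natCast_zmod_val _
    rw [natCast_apply, ← h1]
    simp only [y]
    split_ifs with h
    · rw [h]
    · rw [Nat.cast_add, ZMod.natCast_self, add_zero]
  have hlim : Filter.Tendsto (fun j => (y j : Zs s)) Filter.atTop (nhds x) := by
    rw [tendsto_subtype_rng, tendsto_pi_nhds]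
    intro n
    refine tendsto_const_nhds.congr' ?_
    filter_upwards [Filter.eventually_ge_atTop n] with j hj
    rw [← castHom_apply_eq x hj, ← castHom_apply_eq (y j : Zs s) hj, hyx]
  have h1 := (f.continuous.tendsto x).comp hlim
  have h2 : (f ∘ fun j => (y j : Zs s)) = fun _ => 0 := funext hy0
  rw [h2] at h1
  exact (tendsto_nhds_unique h1 tendsto_const_nhds)

end Integers

/-! ### The concrete shift and its two coefficient algebras -/

section Operators

variable {s : ℕ}

theorem basisVec_apply [DecidableEq (Ball s)] (b c : Ball s) :
    (basisVec s b : ∀ _, ℂ) c = if c = b then 1 else 0 := by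
  by_cases h : c = b
  · subst h; simp [basisVec]
  · simp [basisVec, h]

theorem inner_basisVec (b : Ball s) (g : Hilb s) : inner ℂ (basisVec s b) g = g b := by
  simp [basisVec, lp.inner_single_left]

theorem ext_basisVec {S T : Hilb s →L[ℂ] Hilb s}
    (h : ∀ b, S (basisVec s b) = T (basisVec s b)) : S = T := by
  ext1 g
  have hg := lp.hasSum_single (E := fun _ : Ball s => ℂ) (p := 2) (by norm_num) g
  have h1 : ∀ b, lp.single 2 b (g b) = g b • basisVec s b := fun b => by
    rw [basisVec, ← lp.single_smul, smul_eq_mul, mul_one]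
  refine (S.hasSum hg).unique ?_
  convert T.hasSum hg using 2 with b
  rw [h1, map_smul, map_smul, h]

variable [s.AtLeastTwo]

theorem star_U_mul_U : star (U s) * U s = 1 :=
  (U s).norm_map_iff_adjoint_comp_self.1
    (orthonormal_next s).orthogonalFamily.linearIsometry.norm_map

theorem star_U_basisVec {b : Ball s} (hb : b ∉ Set.range (next s)) :
    star (U s) (basisVec s b) = 0 := by
  classical
  ext c
  rw [← inner_basisVec, ContinuousLinearMap.star_eq_adjoint,
    ContinuousLinearMap.adjoint_inner_right, U_basisVec, inner_basisVec, basisVec_apply, if_neg]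
  · rfl
  · exact fun h => hb ⟨c, h⟩

theorem M_apply (f : C(Zs s, ℂ)) (g : Hilb s) (b : Ball s) :
    M s f g b = f ((b.2 : ℕ) : Zs s) * g b := rfl

theorem M_basisVec (f : C(Zs s, ℂ)) (b : Ball s) :
    M s f (basisVec s b) = f ((b.2 : ℕ) : Zs s) • basisVec s b :=
  diag_basisVec s _ _ _ b

variable (s) in
/-- The representation `f ↦ M_f` of `C(ℤ_s)`. -/
def rep : C(Zs s, ℂ) →⋆ₐ[ℂ] (Hilb s →L[ℂ] Hilb s) where
  toFun := M s
  map_one' := ext_basisVec fun b => by simp [M_basisVec]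
  map_mul' f g := ext_basisVec fun b => by simp [M_basisVec, smul_smul, mul_comm]
  map_zero' := ext_basisVec fun b => by simp [M_basisVec]
  map_add' f g := ext_basisVec fun b => by simp [M_basisVec, add_smul]
  commutes' c := ext_basisVec fun b => by simp [M_basisVec, Algebra.algebraMap_eq_smul_one]
  map_star' f := by
    rw [ContinuousLinearMap.star_eq_adjoint, ContinuousLinearMap.eq_adjoint_iff]
    intro g h
    rw [lp.inner_eq_tsum, lp.inner_eq_tsum]
    refine tsum_congr fun b => ?_
    rw [M_apply, M_apply]
    simp [mul_comm, mul_left_comm]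

theorem rep_apply (f : C(Zs s, ℂ)) : rep s f = M s f := rfl

theorem isShiftRep_rep : IsShiftRep (U s) (rep s)
    (fun f => f.comp ⟨fun x => x + 1, by fun_prop⟩) where
  isometry := star_U_mul_U
  intertwine f := ext_basisVec fun b => by
    simp [rep_apply, M_basisVec, U_basisVec, next]
  surjective f := ⟨f.comp ⟨fun x => x - 1, by fun_prop⟩, by ext x; simp⟩
  faithful f hf := by
    refine eq_zero_of_forall_initial f fun b hb => ?_
    classical
    have h1 : (rep s f * (1 - U s * star (U s))) (basisVec s b) b = 0 := by rw [hf]; rfl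
    -- Basis vectors outside the range of the shift are killed by `U*`, hence fixed by the
    -- projection.
    have h2 : (rep s f * (1 - U s * star (U s))) (basisVec s b) = M s f (basisVec s b) := by
      simp [star_U_basisVec hb, rep_apply]
    rw [h2, M_apply, basisVec_apply, if_pos rfl, mul_one] at h1
    exact h1

variable (s) in
/-- The residue modulo `sⁿ` of an `s`-adic integer. -/
def residue (n : ℕ) (x : Zs s) : Fin (s ^ n) :=
  ⟨((x : ∀ n, ZMod (s ^ n)) n).val, ZMod.val_lt _⟩

theorem residue_eq_iff {n : ℕ} {x y : Zs s} :
    residue s n x = residue s n y ↔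
      (x : ∀ n, ZMod (s ^ n)) n = (y : ∀ n, ZMod (s ^ n)) n := by
  rw [residue, residue, Fin.mk.injEq, (ZMod.val_injective _).eq_iff]

theorem residue_natCast {n : ℕ} (c : Fin (s ^ n)) : residue s n ((c : ℕ) : Zs s) = c := by
  ext
  simp only [residue, natCast_apply]
  exact ZMod.val_cast_of_lt c.isLt

/-- This lets translation by `1` and its inverse descend to residues modulo `sⁿ`. -/
theorem residue_residue_add {n : ℕ} (x y : Zs s) :
    residue s n ((residue s n x : ℕ) + y) = residue s n (x + y) := by
  have h := residue_eq_iff.1 (residue_natCast (residue s n x))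
  rw [residue_eq_iff, Subring.coe_add, Subring.coe_add, Pi.add_apply, Pi.add_apply, h]

theorem continuous_residue (n : ℕ) : Continuous (residue s n) :=
  (continuous_of_discreteTopology (f := fun z : ZMod (s ^ n) =>
    (⟨z.val, ZMod.val_lt z⟩ : Fin (s ^ n)))).comp ((continuous_apply n).comp continuous_subtype_val)

variable (s) in
/-- The inclusion of the functions modulo `sⁿ` into `C(ℤ_s)`. -/
def inflate (n : ℕ) : (Fin (s ^ n) → ℂ) →⋆ₐ[ℂ] C(Zs s, ℂ) where
  toFun g := ⟨fun x => g (residue s n x),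
    continuous_of_discreteTopology.comp (continuous_residue n)⟩
  map_one' := rfl
  map_mul' _ _ := rfl
  map_zero' := rfl
  map_add' _ _ := rfl
  commutes' _ := rfl
  map_star' _ := rfl

theorem inflate_apply {n : ℕ} (g : Fin (s ^ n) → ℂ) (x : Zs s) :
    inflate s n g x = g (residue s n x) := rfl

theorem isShiftRep_inflate (n : ℕ) : IsShiftRep (U s) ((rep s).comp (inflate s n))
    (fun g c => g (residue s n ((c : ℕ) + 1))) where
  isometry := star_U_mul_U
  intertwine g := by
    rw [StarAlgHom.comp_apply, isShiftRep_rep.intertwine, StarAlgHom.comp_apply]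
    congr 2
    ext x
    simp only [ContinuousMap.comp_apply, ContinuousMap.coe_mk, inflate_apply]
    rw [residue_residue_add]
  surjective g := ⟨fun c => g (residue s n ((c : ℕ) - 1)), by
    ext c
    dsimp only
    rw [sub_eq_add_neg, residue_residue_add, add_neg_cancel_right, residue_natCast]⟩
  faithful g hg := by
    -- Faithfulness is inherited from `C(ℤ_s)`, because inflation of functions is injective.
    have h := isShiftRep_rep.faithful _ hg
    ext c
    have h1 : g (residue s n ((c : ℕ) : Zs s)) = 0 := DFunLike.congr_fun h ((c : ℕ) : Zs s)
    rwa [residue_natCast] at h1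

theorem Mball_eq {n : ℕ} (c : Fin (s ^ n)) :
    Mball s ⟨n, c⟩ = (rep s).comp (inflate s n) (Pi.single c 1) := by
  classical
  refine ext_basisVec fun b => ?_
  rw [StarAlgHom.comp_apply, rep_apply, M_basisVec, inflate_apply, Mball, diag_basisVec]
  congr 1
  rw [Pi.single_apply]
  refine if_congr ?_ rfl rfl
  rw [sabs_le_iff, AddSubgroupClass.coe_sub, Pi.sub_apply, sub_eq_zero, ← residue_eq_iff,
    residue_natCast c]

theorem algA_eq : algA s = cstarGen ({U s} ∪ rep s '' Set.univ) := by
  rw [algA]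
  congr 2
  ext T
  simp [rep_apply, eq_comm]

theorem algAn_eq (n : ℕ) : algAn s n = cstarGen ({U s} ∪ (rep s).comp (inflate s n) ''
    Set.range fun c : Fin (s ^ n) => (Pi.single c 1 : Fin (s ^ n) → ℂ)) := by
  rw [algAn]
  congr 2
  ext T
  simp only [Mball_eq, ← Set.range_comp, Set.mem_range, Set.mem_ofPred_eq, Function.comp_apply,
    eq_comm]

theorem shiftIdeal_eq : shiftIdeal s = cstarGen (matrixSet (IsShiftRep.unitMap (U s) (rep s))) := by
  rw [← isShiftRep_rep.cstarGen_matrixSet Submodule.span_univ, shiftIdeal, coeffIdeal]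
  simp only [Set.mem_univ, true_and]
  rfl

theorem shiftIdealn_eq (n : ℕ) : shiftIdealn s n =
    cstarGen (matrixSet (IsShiftRep.unitMap (U s) ((rep s).comp (inflate s n)))) := by
  rw [← (isShiftRep_inflate n).cstarGen_matrixSet (span_range_single (s ^ n)), shiftIdealn, coeffIdealn]
  have h : {T | ∃ (k : ℕ) (x : Fin (s ^ n)), T = P s k * Mball s ⟨n, x⟩} =
      {T | ∃ a ∈ Set.range fun c : Fin (s ^ n) => (Pi.single c 1 : Fin (s ^ n) → ℂ), ∃ k : ℕ,
        T = (rep s).comp (inflate s n) a *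
          (U s ^ k * (1 - U s * star (U s)) * star (U s) ^ k)} := by
    ext T
    -- The generators have the projection on the left; it commutes with the representation.
    simp only [Set.exists_range_iff, Set.mem_ofPred_eq, Mball_eq, P,
      (isShiftRep_inflate n).conj_proj_mul_rep]
    exact exists_comm
  rw [h]

end Operators

end ShiftAlgebra

end

open ShiftAlgebra in
theorem proposition4p1 (s : ℕ) [s.AtLeastTwo]
    {E : Type*} [NormedAddCommGroup E] [InnerProductSpace ℂ E] [CompleteSpace E]
    [TopologicalSpace.SeparableSpace E] (hE : ¬ FiniteDimensional ℂ E) :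
    (IsIdealOf (shiftIdeal s) (algA s) ∧
      Nonempty (shiftIdeal s ≃⋆ₐ[ℂ] CStarTensor C(Zs s, ℂ) (compactOps E))) ∧
    ∀ n : ℕ, IsIdealOf (shiftIdealn s n) (algAn s n) ∧
      Nonempty (shiftIdealn s n ≃⋆ₐ[ℂ] CStarTensor (Fin (s ^ n) → ℂ) (compactOps E)) := by
  refine ⟨⟨?_, ?_⟩, fun n => ⟨?_, ?_⟩⟩
  · rw [shiftIdeal_eq, algA_eq]
    exact isShiftRep_rep.isIdealOf Submodule.span_univ
  · rw [shiftIdeal_eq]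
    refine isShiftRep_rep.isMatrixSystem.nonempty_equiv_tensor hE fun f hf => ?_
    obtain ⟨x, hx⟩ := DFunLike.ne_iff.1 hf
    exact ⟨(ContinuousMap.evalStarAlgHom ℂ ℂ x : C(Zs s, ℂ) →⋆ₙₐ[ℂ] ℂ), hx⟩
  · rw [shiftIdealn_eq, algAn_eq]
    exact (isShiftRep_inflate n).isIdealOf (span_range_single (s ^ n))
  · rw [shiftIdealn_eq]
    refine (isShiftRep_inflate n).isMatrixSystem.nonempty_equiv_tensor hE fun g hg => ?_
    obtain ⟨c, hc⟩ := Function.ne_iff.1 hg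
    exact ⟨(Pi.evalStarAlgHom ℂ (fun _ => ℂ) c : (Fin (s ^ n) → ℂ) →⋆ₙₐ[ℂ] ℂ), hc⟩
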